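/- A rig is a commutative semiring $(A,\cdot,1,+,0)$; its canonical pre-order is $x\le y \iff \exists w,\ w+x=y$. It is integral if $1+x=1$ for all $x$, and residuated if addition is idempotent and every $a\cdot(-)$ has a right adjoint $a\multimap(-)$ for the canonical pre-order; morphisms of residuated rigs preserve $\multimap$. A residuated rig is pre-linear if $(a\multimap b)+(b\multimap a)=1$ for all $a,b$. Let $\mathbf{pliRig}$ be the category of pre-linear integral residuated rigs. A rig in $\mathbf{Set}$ is really local if $\iota:A\to\Omega=\{\bot,\top\}$, $\iota(x)=\top$ iff $x$ is invertible, is a morphism of rigs. For a bounded distributive lattice $D$, let $\mathbf{Shv}(D)$ be the topos of sheaves on $D$ for the topology in which finite families with join $d$ cover $d$, and let $\Lambda_D\in\mathbf{Shv}(D)$ be the distributive lattice $d\mapsto{\downarrow}d=\{c \mid c\le d\}$, with restriction $x\mapsto x\wedge c$, regarded as a rig. A pre-linear representation is a pair $(D,X)$ with $D$ a bounded distributive lattice and $X$ a pre-linear integral residuated rig in $\mathbf{Shv}(D)$ for which there is a (necessarily unique) morphism of rigs $\chi:X\to\Lambda_D$ that is local, i.e. reflects invertibility. A morphism $(D,X)\to(E,Y)$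 is a pair $(f,\phi)$ where $f:D\to E$ is a lattice morphism (preserving $\bot,\top$) and $\phi:X\to f_*Y=Y\circ f^{op}$ is a morphism of residuated rigs in $\mathbf{Shv}(D)$ with $(f_*\chi)\phi=f\chi$, where $f:\Lambda_D\to f_*\Lambda_E$ denotes the map $a\mapsto f(a)$. Let $\mathfrak{plI}$ be the resulting category and $\Gamma:\mathfrak{plI}\to\mathbf{pliRig}$ the functor of global sections, $\Gamma(D,X)=X(\top)$. Theorem. (1) $\Gamma:\mathfrak{plI}\to\mathbf{pliRig}$ has a full and faithful left adjoint; in particular the unit of the adjunction is an isomorphism, so every pre-linear integral residuated rig $A$ is, naturally in $A$, the rig of global sections of a pre-linear representation. Moreover, the left adjoint can be taken to send $A$ to $(LA,\overline{A})$, where $\eta:A\to LA$ is the universal rig map from $A$ to a distributive lattice and, for every $x\in A$, the map $A\cong\overline{A}(\top)\to\overline{A}(\eta x)$ is the localization $A\to A[x^{-1}]$ in integral rigs; here $\eta$ is the composite of the unit $A\to\overline{A}(\top)$ with $\chi_\top$. (2) For every pre-linear representation $(D,X)$ (in particular for $(LA,\overline{A})$) and every point $p:D\to 2$ of the spectrum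 of $D$, the fiber $X_p=\varinjlim_{p(d)=\top}X(d)$ is non-trivial and totally ordered by its canonical pre-order. (3) A pre-linear integral residuated rig (in $\mathbf{Set}$) is really local if and only if it is non-trivial and its canonical pre-order is total. -/

import Mathlib

open CategoryTheory Opposite

universe u

noncomputable section

namespace PrelinearRep

/-! ### Rigs

A rig (commutative, with unit and zero, not necessarily with negatives) is a `CommSemiring`. -/

/-- The canonical pre-order of a rig: `x ≤ y` if and only if `w + x = y` for some `w`. -/
def RigLE {A : Type u} [CommSemiring A] (x y : A) : Prop :=
  ∃ w : A, w + x = y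

/-- A rig is integral if `1 + x = 1` for all `x`. -/
def Integral (A : Type u) [CommSemiring A] : Prop :=
  ∀ x : A, 1 + x = 1

/-- The canonical pre-order is total. (It is antisymmetric as soon as addition is idempotent,
in particular in integral rigs.) -/
def TotallyOrdered (A : Type u) [CommSemiring A] : Prop :=
  ∀ x y : A, RigLE x y ∨ RigLE y x

/-- A rig (in sets) is really local if the characteristic map `x ↦ (x is invertible)` of the
subobject of invertible elements, with values in the lattice of truth values, is a morphism of
rigs. (Preservation of `1` and of products is automatic, but is kept in the definition.) -/
structure ReallyLocal (A : Type u) [CommSemiring A] : Prop where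
  map_zero : IsUnit (0 : A) ↔ False
  map_one : IsUnit (1 : A) ↔ True
  map_add : ∀ x y : A, IsUnit (x + y) ↔ (IsUnit x ∨ IsUnit y)
  map_mul : ∀ x y : A, IsUnit (x * y) ↔ (IsUnit x ∧ IsUnit y)

/-- A residuated rig: addition is idempotent and each `a * (-)` has a right adjoint `res a (-)`
for the canonical pre-order. -/
class ResiduatedRig (A : Type u) extends CommSemiring A where
  add_idem : ∀ a : A, a + a = a
  res : A → A → A
  res_adj : ∀ a x y : A, RigLE (a * x) y ↔ RigLE x (res a y)

/-- Residuated rigs that are integral. -/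
class IntegralResiduatedRig (A : Type u) extends ResiduatedRig A where
  integral : Integral A

open ResiduatedRig (res)

/-- The rig `A` is pre-linear if `(a ⊸ b) + (b ⊸ a) = 1` for all `a`, `b`. -/
def Prelinear (A : Type u) [ResiduatedRig A] : Prop :=
  ∀ a b : A, res a b + res b a = 1

/-- Morphisms of residuated rigs: rig maps that preserve the residuals. -/
structure ResHom (A B : Type u) [ResiduatedRig A] [ResiduatedRig B] extends A →+* B where
  map_res' : ∀ x y : A, toFun (res x y) = res (toFun x) (toFun y)

namespace ResHom

variable {A B C : Type u} [ResiduatedRig A] [ResiduatedRig B] [ResiduatedRig C]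

instance : FunLike (ResHom A B) A B where
  coe f := f.toRingHom
  coe_injective f g h := by
    cases f; cases g; congr; exact DFunLike.coe_injective h

instance : RingHomClass (ResHom A B) A B where
  map_mul f := f.toRingHom.map_mul
  map_one f := f.toRingHom.map_one
  map_add f := f.toRingHom.map_add
  map_zero f := f.toRingHom.map_zero

theorem map_res (f : ResHom A B) (x y : A) : f (res x y) = res (f x) (f y) :=
  f.map_res' x y

@[ext] theorem ext {f g : ResHom A B} (h : ∀ x, f x = g x) : f = g :=
  DFunLike.ext f g h

/-- The identity. -/
def id (A : Type u) [ResiduatedRig A] : ResHom A A where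
  toRingHom := RingHom.id A
  map_res' _ _ := rfl

/-- Composition. -/
def comp (g : ResHom B C) (f : ResHom A B) : ResHom A C where
  toRingHom := g.toRingHom.comp f.toRingHom
  map_res' x y := (congrArg g (f.map_res x y)).trans (g.map_res (f x) (f y))

end ResHom

/-! ### The category of integral residuated rigs -/

/-- Integral residuated rigs, bundled. -/
structure RiRig where
  carrier : Type u
  [str : IntegralResiduatedRig carrier]

attribute [instance] RiRig.str

instance : CoeSort RiRig.{u} (Type u) := ⟨RiRig.carrier⟩

instance : Category.{u} RiRig.{u} where
  Hom A B := ResHom A B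
  id A := ResHom.id A
  comp f g := ResHom.comp g f

instance : ConcreteCategory.{u} RiRig.{u} (fun A B => ResHom A B) where
  hom f := f
  ofHom f := f

instance : HasForget₂ RiRig.{u} CommSemiRingCat.{u} where
  forget₂ :=
    { obj := fun A => CommSemiRingCat.of A
      map := fun f => CommSemiRingCat.ofHom (ConcreteCategory.hom f).toRingHom }

/-- The underlying rig of an integral residuated rig. -/
abbrev toRig : RiRig.{u} ⥤ CommSemiRingCat.{u} := forget₂ RiRig.{u} CommSemiRingCat.{u}

/-! ### Sheaves on a distributive lattice -/

/-- The coherent topology on a (bounded) distributive lattice, seen as a category: a sieve covers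
`d` if and only if it contains a finite family with supremum `d`. -/
def coherentTop (D : BddDistLat.{u}) : GrothendieckTopology D where
  sieves d := {S | ∃ s : Finset D, (∀ c ∈ s, ∃ h : c ≤ d, S.arrows (homOfLE h)) ∧ s.sup id = d}
  top_mem' d := ⟨{d}, by simp, by simp⟩
  pullback_stable' := by
    classical
    rintro d e S f ⟨s, hs, hd⟩
    refine ⟨s.image (fun c => e ⊓ c), ?_, ?_⟩
    · intro c hc
      obtain ⟨c', hc', rfl⟩ := Finset.mem_image.1 hc
      obtain ⟨h, hS⟩ := hs c' hc'
      exact ⟨inf_le_left, S.downward_closed hS (homOfLE inf_le_right)⟩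
    · rw [Finset.sup_image]
      change s.sup (fun c => e ⊓ id c) = e
      rw [← Finset.sup_inf_distrib_left, hd]
      exact inf_eq_left.2 (leOfHom f)
  transitive' := by
    classical
    rintro d S ⟨s, hs, hd⟩ R hR
    have key : ∀ c ∈ s, ∃ t : Finset D,
        (∀ b ∈ t, ∃ h : b ≤ d, R.arrows (homOfLE h)) ∧ t.sup id = c := by
      intro c hc
      obtain ⟨h, hS⟩ := hs c hc
      obtain ⟨t, ht, htc⟩ := hR hS
      exact ⟨t, fun b hb => ⟨(ht b hb).1.trans h, (ht b hb).2⟩, htc⟩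
    choose! t ht htc using key
    refine ⟨s.biUnion t, ?_, ?_⟩
    · intro b hb
      obtain ⟨c, hc, hbc⟩ := Finset.mem_biUnion.1 hb
      exact ht c hc b hbc
    · rw [Finset.sup_biUnion, ← hd]
      exact Finset.sup_congr rfl htc

/-- The principal lower set of `d`. -/
def Below {D : Type u} [LE D] (d : D) : Type u := {c : D // c ≤ d}

/-- The principal lower set `↓d` of a distributive lattice as a rig, with addition `⊔`,
multiplication `⊓`, zero `⊥` and unit `d`. -/
instance {D : Type u} [DistribLattice D] [BoundedOrder D] (d : D) : CommSemiring (Below d) where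
  add x y := ⟨x.1 ⊔ y.1, sup_le x.2 y.2⟩
  mul x y := ⟨x.1 ⊓ y.1, inf_le_left.trans x.2⟩
  zero := ⟨⊥, bot_le⟩
  one := ⟨d, le_rfl⟩
  add_assoc x y z := Subtype.ext (sup_assoc x.1 y.1 z.1)
  add_comm x y := Subtype.ext (sup_comm x.1 y.1)
  zero_add x := Subtype.ext (bot_sup_eq x.1)
  add_zero x := Subtype.ext (sup_bot_eq x.1)
  mul_assoc x y z := Subtype.ext (inf_assoc x.1 y.1 z.1)
  mul_comm x y := Subtype.ext (inf_comm x.1 y.1)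
  one_mul x := Subtype.ext (inf_eq_right.2 x.2)
  mul_one x := Subtype.ext (inf_eq_left.2 x.2)
  zero_mul x := Subtype.ext (bot_inf_eq x.1)
  mul_zero x := Subtype.ext (inf_bot_eq x.1)
  left_distrib x y z := Subtype.ext (inf_sup_left x.1 y.1 z.1)
  right_distrib x y z := Subtype.ext (inf_sup_right x.1 y.1 z.1)
  nsmul n x := n.rec ⟨⊥, bot_le⟩ (fun _ y => ⟨y.1 ⊔ x.1, sup_le y.2 x.2⟩)
  npow n x := n.rec ⟨d, le_rfl⟩ (fun _ y => ⟨y.1 ⊓ x.1, inf_le_left.trans y.2⟩)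

/-- For `c ≤ d`, the restriction `↓d → ↓c` that sends `x` to `x ⊓ c`. -/
def Below.restrict {D : Type u} [DistribLattice D] [BoundedOrder D] {c d : D} (h : c ≤ d) :
    Below d →+* Below c where
  toFun x := ⟨x.1 ⊓ c, inf_le_right⟩
  map_one' := Subtype.ext (inf_eq_right.2 h)
  map_mul' x y := Subtype.ext (inf_inf_distrib_right x.1 y.1 c)
  map_zero' := Subtype.ext (bot_inf_eq c)
  map_add' x y := Subtype.ext (inf_sup_right x.1 y.1 c)

/-- The rig `Λ` on the lattice `D`, that sends `d` to `↓d`. -/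
def Lambda (D : BddDistLat.{u}) : (D : Type u)ᵒᵖ ⥤ CommSemiRingCat.{u} where
  obj d := CommSemiRingCat.of (Below d.unop)
  map i := CommSemiRingCat.ofHom (Below.restrict (leOfHom i.unop))
  map_id d := by
    ext x
    exact Subtype.ext (inf_eq_left.2 x.2)
  map_comp {a b c} i j := by
    ext x
    refine Subtype.ext ?_
    change x.1 ⊓ c.unop = x.1 ⊓ b.unop ⊓ c.unop
    rw [inf_assoc, inf_eq_right.2 (leOfHom j.unop)]

/-- The functor induced by a lattice morphism. Precomposition with it is the direct image functor
`f_*`. -/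
def latFun {D E : BddDistLat.{u}} (f : D ⟶ E) : (D : Type u)ᵒᵖ ⥤ (E : Type u)ᵒᵖ :=
  Monotone.functor (f := f.hom) (OrderHomClass.mono f.hom) |>.op

/-- The morphism `Λ_D ⟶ f_* Λ_E` induced by a lattice morphism `f : D ⟶ E`; at stage `d` it sends
`a ≤ d` to `f a ≤ f d`. -/
def lambdaMap {D E : BddDistLat.{u}} (f : D ⟶ E) : Lambda D ⟶ latFun f ⋙ Lambda E where
  app d := CommSemiRingCat.ofHom
    { toFun := fun a => (⟨f.hom a.1, OrderHomClass.mono f.hom a.2⟩ : Below (f.hom d.unop))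
      map_one' := rfl
      map_mul' := fun x y => Subtype.ext (map_inf f.hom x.1 y.1)
      map_zero' := Subtype.ext (map_bot f.hom)
      map_add' := fun x y => Subtype.ext (map_sup f.hom x.1 y.1) }
  naturality d e i := by
    ext x
    exact Subtype.ext (map_inf f.hom x.1 e.unop)

/-! ### Representations -/

/-- A residuated representation: a distributive lattice `base`, an integral residuated rig `X`
in the topos of sheaves on `base` (that is, a presheaf of integral residuated rigs whose presheaf
of underlying sets is a sheaf), such that there is a local morphism of rigs `χ : X ⟶ Λ`, where
local means that it reflects invertibility. The morphism `χ` is unique, see `chi_unique`, so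
recording it is recording a property of `X`. -/
structure ResRep where
  base : BddDistLat.{u}
  X : (base : Type u)ᵒᵖ ⥤ RiRig.{u}
  isSheaf : Presieve.IsSheaf (coherentTop base) (X ⋙ forget RiRig.{u})
  χ : X ⋙ toRig ⟶ Lambda base
  isLocal : ∀ d, IsLocalHom (χ.app d).hom

theorem eq_one_of_isUnit {A : Type u} [CommSemiring A] (hA : Integral A) {x : A}
    (hx : IsUnit x) : x = 1 := by
  obtain ⟨y, hy⟩ := hx.exists_right_inv
  have h1 : x + 1 = x := by
    calc x + 1 = x * 1 + x * y := by rw [mul_one, hy]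
      _ = x * (1 + y) := (mul_add _ _ _).symm
      _ = x := by rw [hA, mul_one]
  rw [← h1, add_comm, hA]

/-- The value `χ x` is the largest `c ≤ d` such that the restriction of `x` to `c` is `1`. -/
theorem le_chi_iff (D : BddDistLat.{u}) (X : (D : Type u)ᵒᵖ ⥤ RiRig.{u})
    (χ : X ⋙ toRig ⟶ Lambda D) (hχ : ∀ d, IsLocalHom (χ.app d).hom)
    {c d : D} (h : c ≤ d) (x : X.obj (op d)) :
    c ≤ Subtype.val ((χ.app (op d)).hom x : Below d) ↔
      (X.map (homOfLE h).op : ResHom _ _) x = 1 := by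
  have nat : (χ.app (op c)).hom ((X.map (homOfLE h).op : ResHom _ _) x) =
      Below.restrict h ((χ.app (op d)).hom x) :=
    congrArg (fun k => k.hom x) (χ.naturality (homOfLE h).op)
  constructor
  · intro hc
    have h1 : (χ.app (op c)).hom ((X.map (homOfLE h).op : ResHom _ _) x) =
        (1 : Below c) := nat.trans (Subtype.ext (inf_eq_right.2 hc))
    have := hχ (op c)
    have hu : IsUnit ((X.map (homOfLE h).op : ResHom _ _) x) := by
      refine isUnit_of_map_unit (χ.app (op c)).hom _ ?_
      rw [h1]
      exact isUnit_one
    exact eq_one_of_isUnit (X.obj (op c)).str.integral hu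
  · intro h1
    rw [h1] at nat
    have h2 : (1 : Below c) = Below.restrict h ((χ.app (op d)).hom x) :=
      (map_one (χ.app (op c)).hom).symm.trans nat
    exact inf_eq_right.1 (congrArg Subtype.val h2).symm

/-- A local morphism to `Λ` is unique. -/
theorem chi_unique (D : BddDistLat.{u}) (X : (D : Type u)ᵒᵖ ⥤ RiRig.{u})
    (χ χ' : X ⋙ toRig ⟶ Lambda D) (hχ : ∀ d, IsLocalHom (χ.app d).hom)
    (hχ' : ∀ d, IsLocalHom (χ'.app d).hom) : χ = χ' := by
  ext ⟨d⟩ x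
  apply Subtype.ext
  apply le_antisymm
  · exact (le_chi_iff D X χ' hχ' (Subtype.property ((χ.app (op d)).hom x : Below d)) x).2
      ((le_chi_iff D X χ hχ _ x).1 le_rfl)
  · exact (le_chi_iff D X χ hχ (Subtype.property ((χ'.app (op d)).hom x : Below d)) x).2
      ((le_chi_iff D X χ' hχ' _ x).1 le_rfl)

namespace ResRep

/-- A morphism `(D, X) ⟶ (E, Y)` of representations is a lattice morphism `f : D ⟶ E` with a
morphism `φ : X ⟶ f_* Y` of residuated rigs in sheaves on `D`, compatible with the canonical
morphisms to `Λ_D` and `f_* Λ_E`. -/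
@[ext] structure Hom (P Q : ResRep.{u}) where
  f : P.base ⟶ Q.base
  φ : P.X ⟶ latFun f ⋙ Q.X
  comm : Functor.whiskerRight φ toRig ≫ Functor.whiskerLeft (latFun f) Q.χ = P.χ ≫ lambdaMap f

/-- The identity of a representation. -/
def Hom.id (P : ResRep.{u}) : Hom P P where
  f := 𝟙 P.base
  φ := { app := fun d => 𝟙 (P.X.obj d) }
  comm := by
    ext d x
    rfl

/-- Composition: `(f, φ)` and `(g, γ)` compose to `(g f, (f_* γ) φ)`. -/
def Hom.comp {P Q R : ResRep.{u}} (F : Hom P Q) (G : Hom Q R) : Hom P R where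
  f := F.f ≫ G.f
  φ :=
    { app := fun d => F.φ.app d ≫ G.φ.app ((latFun F.f).obj d)
      naturality := fun d e i => ResHom.ext fun x => by
        have h1 := congrArg (fun k : ResHom _ _ => k x) (F.φ.naturality i)
        have h2 := congrArg (fun k : ResHom _ _ => k (F.φ.app d x))
          (G.φ.naturality ((latFun F.f).map i))
        exact (congrArg (G.φ.app ((latFun F.f).obj e)) h1).trans h2 }
  comm := by
    ext d x
    have h1 := congrArg (fun k => (k.app d).hom x) F.comm
    have h2 := congrArg (fun k => (k.app ((latFun F.f).obj d)).hom (F.φ.app d x)) G.comm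
    exact h2.trans (congrArg ((lambdaMap G.f).app ((latFun F.f).obj d)).hom h1)

instance : Category.{u} ResRep.{u} where
  Hom := Hom
  id := Hom.id
  comp := Hom.comp

end ResRep

/-- The functor of global sections `Γ`: it sends `(D, X)` to `X ⊤`, and `(f, φ)` to
`φ_⊤ : X ⊤ ⟶ Y (f ⊤) = Y ⊤`. -/
def Gamma : ResRep.{u} ⥤ RiRig.{u} where
  obj P := P.X.obj (op ⊤)
  map {P Q} F := F.φ.app (op ⊤) ≫
    Q.X.map (homOfLE (map_top F.f.hom).ge : (⊤ : Q.base) ⟶ F.f.hom ⊤).op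
  map_id P := P.X.map_id _
  map_comp {P Q R} F G := ResHom.ext fun x => by
    have h := congrArg (fun k : ResHom _ _ => (R.X.map (homOfLE (map_top G.f.hom).ge :
        (⊤ : R.base) ⟶ G.f.hom ⊤).op) (k (F.φ.app (op ⊤) x)))
      (G.φ.naturality (homOfLE (map_top F.f.hom).ge : (⊤ : Q.base) ⟶ F.f.hom ⊤).op)
    have h2 := congrArg
      (fun k : ResHom _ _ => k (G.φ.app (op (F.f.hom ⊤)) (F.φ.app (op ⊤) x)))
      (R.X.map_comp
        ((latFun G.f).map (homOfLE (map_top F.f.hom).ge : (⊤ : Q.base) ⟶ F.f.hom ⊤).op)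
        (homOfLE (map_top G.f.hom).ge : (⊤ : R.base) ⟶ G.f.hom ⊤).op)
    exact h2.trans h.symm

/-! ### The pre-linear case -/

/-- Pre-linearity, as a property of integral residuated rigs. -/
def prelinearRig : ObjectProperty RiRig.{u} := fun A => Prelinear A

/-- Pre-linearity of `X` as a residuated rig in sheaves, that is, at every stage. -/
def prelinearRep : ObjectProperty ResRep.{u} := fun P => ∀ d, Prelinear (P.X.obj d)

/-- The category of pre-linear integral residuated rigs. -/
abbrev PliRig := prelinearRig.{u}.FullSubcategory

/-- The category of pre-linear representations. -/
abbrev PlRep := prelinearRep.{u}.FullSubcategory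

/-- The restriction of `Γ` to pre-linear representations. -/
def GammaPl : PlRep.{u} ⥤ PliRig.{u} :=
  prelinearRig.lift (prelinearRep.ι ⋙ Gamma) (fun P => P.property (op ⊤))

/-! ### Fibers -/

section Stalk

variable {D : BddDistLat.{u}} (X : (D : Type u)ᵒᵖ ⥤ RiRig.{u}) (p : BoundedLatticeHom D Bool)

/-- The elements `d` of the lattice such that `p d = ⊤`, ordered by reverse inclusion. The point
`p` of the spectrum is a lattice morphism to the two-element lattice. -/
abbrev Nhd : Type u := {d : D // p d = ⊤}ᵒᵈ

instance : Nonempty (Nhd p) := ⟨OrderDual.toDual ⟨⊤, map_top p⟩⟩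

instance : IsDirectedOrder (Nhd p) where
  directed a b := ⟨OrderDual.toDual ⟨a.ofDual.1 ⊓ b.ofDual.1, by
    rw [map_inf, a.ofDual.2, b.ofDual.2, inf_top_eq]⟩,
    (inf_le_left : a.ofDual.1 ⊓ b.ofDual.1 ≤ a.ofDual.1),
    (inf_le_right : a.ofDual.1 ⊓ b.ofDual.1 ≤ b.ofDual.1)⟩

/-- The restriction maps between the neighbourhoods of `p`. -/
def nhdMap (i j : Nhd p) (h : i ≤ j) :
    ResHom (X.obj (op i.ofDual.1)) (X.obj (op j.ofDual.1)) :=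
  X.map (homOfLE (show j.ofDual.1 ≤ i.ofDual.1 from h)).op

instance : DirectedSystem (fun i : Nhd p => X.obj (op i.ofDual.1)) (nhdMap X p · · ·) where
  map_self i x := congrArg (fun k : ResHom _ _ => k x) (X.map_id (op i.ofDual.1))
  map_map k j i hij hjk x := congrArg (fun k : ResHom _ _ => k x)
    (X.map_comp (homOfLE (show j.ofDual.1 ≤ i.ofDual.1 from hij)).op
      (homOfLE (show k.ofDual.1 ≤ j.ofDual.1 from hjk)).op).symm

/-- The fiber of `X` at the point `p`: the filtered colimit of the `X d` with `p d = ⊤`. -/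
abbrev Stalk : Type u :=
  DirectLimit (fun i : Nhd p => X.obj (op i.ofDual.1)) (nhdMap X p)

theorem rigLE_iff {A : Type u} [ResiduatedRig A] (x y : A) : RigLE x y ↔ x + y = y := by
  constructor
  · rintro ⟨w, rfl⟩
    rw [add_left_comm, ResiduatedRig.add_idem]
  · intro h
    exact ⟨y, by rw [add_comm, h]⟩

/-- The fiber is again an integral residuated rig, with operations induced by those of the
`X d`. -/
instance : IntegralResiduatedRig (Stalk X p) :=
  let r : Stalk X p → Stalk X p → Stalk X p :=
    DirectLimit.map₂ (nhdMap X p) (nhdMap X p) (nhdMap X p) (fun _ x y => res x y)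
      (fun i j h x y => (nhdMap X p i j h).map_res x y)
  have idem : ∀ a : Stalk X p, a + a = a := DirectLimit.induction _ fun i x => by
    rw [DirectLimit.add_def, ResiduatedRig.add_idem]
  have le_iff : ∀ x y : Stalk X p, RigLE x y ↔ x + y = y := fun x y => by
    constructor
    · rintro ⟨w, rfl⟩
      rw [add_left_comm, idem]
    · intro h
      exact ⟨y, by rw [add_comm, h]⟩
  { add_idem := idem
    res := r
    res_adj := DirectLimit.induction₃ _ fun i a x y => by
      have hr : r ⟦⟨i, a⟩⟧ ⟦⟨i, y⟩⟧ = ⟦⟨i, res a y⟩⟧ := DirectLimit.map₂_def ..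
      rw [le_iff, le_iff, hr, DirectLimit.mul_def, DirectLimit.add_def, DirectLimit.add_def,
        Quotient.eq, Quotient.eq]
      have key : ∀ (j : Nhd p) (h : i ≤ j),
          nhdMap X p i j h (a * x + y) = nhdMap X p i j h y ↔
          nhdMap X p i j h (x + res a y) = nhdMap X p i j h (res a y) := by
        intro j h
        rw [map_add, map_mul, map_add, ResHom.map_res, ← rigLE_iff, ← rigLE_iff]
        exact ResiduatedRig.res_adj _ _ _
      constructor
      · rintro ⟨j, h, _, e⟩
        exact ⟨j, h, h, (key j h).1 e⟩
      · rintro ⟨j, h, _, e⟩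
        exact ⟨j, h, h, (key j h).2 e⟩
    integral := DirectLimit.induction _ fun i x => by
      rw [DirectLimit.one_def i, DirectLimit.add_def, (X.obj (op i.ofDual.1)).str.integral] }

end Stalk

/-! ### Reticulation and localization -/

/-- The map `η : A →+* ↓⊤` (where `↓⊤` is the lattice `D` regarded as a rig) is the reticulation
of `A`: it is universal among the rig maps from `A` to distributive lattices. -/
def IsReticulation {A : Type u} [CommSemiring A] {D : BddDistLat.{u}}
    (η : A →+* Below (⊤ : D)) : Prop :=
  ∀ (E : BddDistLat.{u}) (g : A →+* Below (⊤ : E)),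
    ∃! f : D ⟶ E, ∀ x : A, f.hom (η x).1 = (g x).1

/-- The map `ℓ : A →+* B` is the localization `A → A[x⁻¹]` in integral rigs: it inverts `x`, and it
is universal with this property among the rig maps from `A` to integral rigs. -/
def IsLocalizationAt {A B : Type u} [CommSemiring A] [CommSemiring B] (x : A) (ℓ : A →+* B) :
    Prop :=
  IsUnit (ℓ x) ∧ ∀ (C : Type u) [CommSemiring C], Integral C → ∀ g : A →+* C, IsUnit (g x) →
    ∃! h : B →+* C, h.comp ℓ = g

/-- The rig map from an integral residuated rig `A` to the lattice of a representation `(D, X)`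
obtained from a morphism `u : A ⟶ X ⊤` by composition with `χ_⊤`. -/
def toBase {A : RiRig.{u}} (P : ResRep.{u}) (u : A ⟶ Gamma.obj P) :
    A →+* Below (⊤ : P.base) :=
  RingHom.comp (P.χ.app (op ⊤)).hom (ConcreteCategory.hom u).toRingHom

/-- The rig map `A → X d` obtained from a morphism `u : A ⟶ X ⊤` by restriction to `d`. -/
def toSection {A : RiRig.{u}} (P : ResRep.{u}) (u : A ⟶ Gamma.obj P) (d : P.base) :
    A →+* P.X.obj (op d) :=
  (ConcreteCategory.hom (u ≫ P.X.map (homOfLE (le_top : d ≤ ⊤)).op)).toRingHom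

end PrelinearRep

end

noncomputable section

namespace PrelinearRep

open ResiduatedRig (res)

/-! ### The order of an integral residuated rig -/

section Order

variable {A : Type u} [IntegralResiduatedRig A]

/-! In an integral residuated rig `a ≤ b` is the equation `a ⊸ b = 1`, and `1` is the only unit.
Ordering by "some power of `x` is below `y`" makes products meets and sums joins; the poset
reflection is the reticulation `LA`, with `η` the class map. An element `d` of `LA` cuts out the
filter of those `a` with `d ≤ η a`, and the sections over `d` are `A` modulo it. There `a ≤ b` means
`d ≤ η (a ⊸ b)`; for `d = η x` this is `a * x ^ n ≤ b` for some `n`, so the quotient is `A[x⁻¹]`.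
The condition passes to joins of `d`, whence separation; gluing is a sum weighted by high powers
(`FilterQuot.exists_glue`). At `⊤` the filter is `{1}`, so the unit is an isomorphism. A map `u : A
→ X ⊤` gives `χ u : A → D`, hence `f : LA → D`. Since `χ x` is the largest element over which `x`
becomes `1`, `u` followed by restriction to `f d` factors through the quotient at `d`. Uniqueness
holds because `η` and all the projections are surjective. Pre-linearity, being an equation, passes
to quotients. It gives `χ (a ⊸ b) ⊔ χ (b ⊸ a) = d`, and a point of the spectrum must select one
side, so fibers are totally ordered. The same argument with units gives the characterization of
really local rigs. -/

theorem RigLE.refl (x : A) : RigLE x x := ⟨0, zero_add x⟩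

theorem RigLE.trans {x y z : A} (h : RigLE x y) (h' : RigLE y z) : RigLE x z := by
  obtain ⟨v, rfl⟩ := h
  obtain ⟨w, rfl⟩ := h'
  exact ⟨w + v, add_assoc w v x⟩

/-- Integrality alone gives idempotence, `a + a = a * (1 + 1) = a`. Residuals are not assumed
because the localization property tests against arbitrary integral rigs. -/
theorem RigLE.antisymm {A : Type u} [CommSemiring A] (hA : Integral A) {x y : A}
    (h : RigLE x y) (h' : RigLE y x) : x = y := by
  have idem : ∀ a : A, a + a = a := fun a => by
    rw [← mul_one a, ← mul_add, hA]
  have key : ∀ {a b : A}, RigLE a b → a + b = b := by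
    rintro a _ ⟨w, rfl⟩
    rw [add_left_comm, idem]
  rw [← key h', add_comm, key h]

theorem RigLE.map {A B F : Type u} [CommSemiring A] [CommSemiring B] [FunLike F A B]
    [RingHomClass F A B] (f : F) {x y : A} (h : RigLE x y) : RigLE (f x) (f y) := by
  obtain ⟨w, rfl⟩ := h
  exact ⟨f w, (map_add f w x).symm⟩

theorem rigLE_add_left {A : Type u} [CommSemiring A] (x y : A) : RigLE x (x + y) :=
  ⟨y, add_comm y x⟩

theorem rigLE_add_right {A : Type u} [CommSemiring A] (x y : A) : RigLE y (x + y) := ⟨x, rfl⟩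

theorem RigLE.add {A : Type u} [CommSemiring A] {x y x' y' : A} (h : RigLE x y)
    (h' : RigLE x' y') : RigLE (x + x') (y + y') := by
  obtain ⟨v, rfl⟩ := h
  obtain ⟨w, rfl⟩ := h'
  exact ⟨v + w, add_add_add_comm v w x x'⟩

theorem add_rigLE {x y z : A} (h : RigLE x z) (h' : RigLE y z) : RigLE (x + y) z := by
  have := h.add h'
  rwa [ResiduatedRig.add_idem] at this

theorem RigLE.mul_left {A : Type u} [CommSemiring A] (a : A) {x y : A} (h : RigLE x y) :
    RigLE (a * x) (a * y) := by
  obtain ⟨w, rfl⟩ := h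
  exact ⟨a * w, (mul_add a w x).symm⟩

theorem RigLE.mul {x y x' y' : A} (h : RigLE x y) (h' : RigLE x' y') :
    RigLE (x * x') (y * y') := by
  refine (h'.mul_left x).trans ?_
  rw [mul_comm x, mul_comm y]
  exact h.mul_left y'

theorem rigLE_one (x : A) : RigLE x 1 := ⟨1, IntegralResiduatedRig.integral x⟩

theorem zero_rigLE {A : Type u} [CommSemiring A] (x : A) : RigLE 0 x := ⟨x, add_zero x⟩

theorem mul_rigLE_left (x y : A) : RigLE (x * y) x := by
  simpa using (RigLE.refl x).mul (rigLE_one y)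

theorem mul_rigLE_right (x y : A) : RigLE (x * y) y := by
  simpa using (rigLE_one x).mul (RigLE.refl y)

theorem mul_res_rigLE (a b : A) : RigLE (a * res a b) b :=
  (ResiduatedRig.res_adj a _ b).2 (RigLE.refl _)

theorem eq_one_iff_rigLE (x : A) : x = 1 ↔ RigLE 1 x :=
  ⟨fun h => h ▸ RigLE.refl x,
    fun h => RigLE.antisymm IntegralResiduatedRig.integral (rigLE_one x) h⟩

theorem res_eq_one_iff (a b : A) : res a b = 1 ↔ RigLE a b := by
  rw [eq_one_iff_rigLE, ← ResiduatedRig.res_adj, mul_one]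

theorem one_res (a : A) : res 1 a = a := by
  refine RigLE.antisymm IntegralResiduatedRig.integral ?_ ?_
  · simpa using mul_res_rigLE 1 a
  · rw [← ResiduatedRig.res_adj, one_mul]
    exact RigLE.refl a

theorem isUnit_iff_eq_one (x : A) : IsUnit x ↔ x = 1 :=
  ⟨eq_one_of_isUnit IntegralResiduatedRig.integral, fun h => h ▸ isUnit_one⟩

theorem RigLE.pow {x y : A} (h : RigLE x y) (n : ℕ) : RigLE (x ^ n) (y ^ n) := by
  induction n with
  | zero => simpa using RigLE.refl (1 : A)
  | succ n ih => simpa only [pow_succ] using ih.mul h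

theorem pow_rigLE_pow (x : A) {m n : ℕ} (h : m ≤ n) : RigLE (x ^ n) (x ^ m) := by
  rw [← Nat.sub_add_cancel h, pow_add]
  exact mul_rigLE_right _ _

/-- Every term of the binomial expansion has `x ^ m` or `y ^ n` as a factor, and a product lies
below each of its factors. -/
theorem add_pow_rigLE {x y z : A} {m n : ℕ} (hx : RigLE (x ^ m) z) (hy : RigLE (y ^ n) z) :
    RigLE ((x + y) ^ (m + n)) z := by
  rw [add_pow]
  refine Finset.sum_induction _ (fun t => RigLE t z) (fun _ _ => add_rigLE) (zero_rigLE z) ?_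
  intro k hk
  refine (mul_rigLE_left _ _).trans ?_
  rcases le_total m k with h | h
  · exact ((mul_rigLE_left _ _).trans (pow_rigLE_pow x h)).trans hx
  · exact ((mul_rigLE_right _ _).trans (pow_rigLE_pow y (by omega))).trans hy

end Order

/-! ### The reticulation -/

section Reticulation

variable (A : Type u) [IntegralResiduatedRig A]

/-- The radical pre-order: some power of `x` is below `y`. -/
def RadLE {A : Type u} [CommSemiring A] (x y : A) : Prop := ∃ n : ℕ, RigLE (x ^ n) y

variable {A} in
theorem RigLE.radLE {x y : A} (h : RigLE x y) : RadLE x y := ⟨1, by rwa [pow_one]⟩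

variable {A} in
theorem RadLE.trans {x y z : A} (h : RadLE x y) (h' : RadLE y z) : RadLE x z := by
  obtain ⟨m, hm⟩ := h
  obtain ⟨n, hn⟩ := h'
  exact ⟨m * n, by rw [pow_mul]; exact (hm.pow n).trans hn⟩

/-- The equivalence relation of the radical pre-order. -/
def radSetoid : Setoid A where
  r x y := RadLE x y ∧ RadLE y x
  iseqv :=
    { refl := fun x => ⟨(RigLE.refl x).radLE, (RigLE.refl x).radLE⟩
      symm := And.symm
      trans := fun h h' => ⟨h.1.trans h'.1, h'.2.trans h.2⟩ }

/-- The reticulation of an integral residuated rig: the poset reflection of the radical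
pre-order. -/
def Retic : Type u := Quotient (radSetoid A)

variable {A}

/-- The class of an element in the reticulation. -/
def Retic.mk (x : A) : Retic A := Quotient.mk (radSetoid A) x

theorem Retic.mk_surjective : Function.Surjective (Retic.mk : A → Retic A) :=
  Quotient.mk_surjective

variable {x y z : A}

/-- Adding exponents turns the product into a meet, although multiplication in `A` need not be
idempotent. -/
theorem RadLE.inf (h : RadLE x y) (h' : RadLE x z) : RadLE x (y * z) := by
  obtain ⟨m, hm⟩ := h
  obtain ⟨n, hn⟩ := h'
  exact ⟨m + n, by rw [pow_add]; exact hm.mul hn⟩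

theorem RadLE.sup (h : RadLE x z) (h' : RadLE y z) : RadLE (x + y) z := by
  obtain ⟨m, hm⟩ := h
  obtain ⟨n, hn⟩ := h'
  exact ⟨m + n, add_pow_rigLE hm hn⟩

instance : PartialOrder (Retic A) where
  le := Quotient.lift₂ RadLE fun _ _ _ _ h h' =>
    propext ⟨fun k => (h.2.trans k).trans h'.1, fun k => (h.1.trans k).trans h'.2⟩
  le_refl := Quotient.ind fun x => (RigLE.refl x).radLE
  le_trans a b c := by
    induction a, b using Quotient.ind₂
    induction c using Quotient.ind
    exact RadLE.trans
  le_antisymm a b := by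
    induction a, b using Quotient.ind₂
    exact fun h h' => Quotient.sound ⟨h, h'⟩

theorem Retic.mk_le_mk : Retic.mk x ≤ Retic.mk y ↔ RadLE x y := Iff.rfl

theorem Retic.mk_mono (h : RigLE x y) : Retic.mk x ≤ Retic.mk y := h.radLE

instance : Lattice (Retic A) where
  sup := Quotient.map₂ (· + ·) fun _ _ h _ _ h' =>
    ⟨(h.1.trans (rigLE_add_left _ _).radLE).sup (h'.1.trans (rigLE_add_right _ _).radLE),
      (h.2.trans (rigLE_add_left _ _).radLE).sup (h'.2.trans (rigLE_add_right _ _).radLE)⟩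
  inf := Quotient.map₂ (· * ·) fun _ _ h _ _ h' =>
    ⟨((mul_rigLE_left _ _).radLE.trans h.1).inf ((mul_rigLE_right _ _).radLE.trans h'.1),
      ((mul_rigLE_left _ _).radLE.trans h.2).inf ((mul_rigLE_right _ _).radLE.trans h'.2)⟩
  le_sup_left := Quotient.ind₂ fun _ _ => (rigLE_add_left _ _).radLE
  le_sup_right := Quotient.ind₂ fun _ _ => (rigLE_add_right _ _).radLE
  sup_le a b c := by
    induction a, b using Quotient.ind₂
    induction c using Quotient.ind
    exact RadLE.sup
  inf_le_left := Quotient.ind₂ fun _ _ => (mul_rigLE_left _ _).radLE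
  inf_le_right := Quotient.ind₂ fun _ _ => (mul_rigLE_right _ _).radLE
  le_inf a b c := by
    induction a, b using Quotient.ind₂
    induction c using Quotient.ind
    exact RadLE.inf

instance : DistribLattice (Retic A) :=
  DistribLattice.ofInfSupLe fun a b c => by
    induction a, b using Quotient.ind₂
    induction c using Quotient.ind
    exact Retic.mk_mono (by simp only [mul_add]; exact RigLE.refl _)

instance : BoundedOrder (Retic A) where
  top := Retic.mk 1
  bot := Retic.mk 0
  le_top := Quotient.ind fun x => (rigLE_one x).radLE
  bot_le := Quotient.ind fun x => (zero_rigLE x).radLE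

namespace Retic

/-- The exponent must be positive: `x ^ 0 = 1` has class `⊤`. -/
theorem mk_pow_succ (n : ℕ) : mk (x ^ (n + 1)) = mk x :=
  le_antisymm (mk_mono (by rw [pow_succ]; exact mul_rigLE_right _ _))
    (mk_le_mk.2 ⟨n + 1, RigLE.refl _⟩)

theorem top_le_mk_iff : ⊤ ≤ mk x ↔ x = 1 := by
  rw [eq_one_iff_rigLE]
  refine ⟨fun ⟨n, hn⟩ => by rwa [one_pow] at hn, mk_mono⟩

/-- Multiplication in a lattice is idempotent, so powers of `x` have image at least that of `x`. -/
theorem map_mono_of_ringHom {E : Type u} [DistribLattice E] [BoundedOrder E]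
    (g : A →+* Below (⊤ : E)) (h : RadLE x y) : (g x).1 ≤ (g y).1 := by
  obtain ⟨n, w, rfl⟩ := h
  have key : ∀ n : ℕ, (g x).1 ≤ (g (x ^ n)).1 := fun n => by
    induction n with
    | zero => rw [pow_zero, map_one]; exact (g x).2
    | succ n ih =>
      rw [pow_succ, map_mul]
      exact le_inf ih le_rfl
  rw [map_add]
  exact (key n).trans le_sup_right

/-- The lattice morphism induced by a rig map to a distributive lattice. -/
def lift {E : BddDistLat.{u}} (g : A →+* Below (⊤ : E)) : BddDistLat.of (Retic A) ⟶ E :=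
  BddDistLat.ofHom
    { toFun := Quotient.lift (fun x => (g x).1) fun _ _ h =>
        le_antisymm (map_mono_of_ringHom g h.1) (map_mono_of_ringHom g h.2)
      map_sup' := Quotient.ind₂ fun x y => congrArg Subtype.val (map_add g x y)
      map_inf' := Quotient.ind₂ fun x y => congrArg Subtype.val (map_mul g x y)
      map_top' := congrArg Subtype.val (map_one g)
      map_bot' := congrArg Subtype.val (map_zero g) }

theorem lift_mk {E : BddDistLat.{u}} (g : A →+* Below (⊤ : E)) (x : A) :
    (lift g).hom (mk x) = (g x).1 := rfl

end Retic

/-! ### Congruences -/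

/-- The pre-order `a ≤ b` modulo the filter of `d`. -/
def FilterLE (d : Retic A) (a b : A) : Prop := d ≤ Retic.mk (res a b)

/-- With an explicit multiplier `z`, compatibility with the operations reduces to multiplying
witnesses. -/
theorem filterLE_iff {d : Retic A} {a b : A} :
    FilterLE d a b ↔ ∃ z, d ≤ Retic.mk z ∧ RigLE (z * a) b := by
  constructor
  · exact fun h => ⟨_, h, by rw [mul_comm]; exact mul_res_rigLE a b⟩
  · rintro ⟨z, hz, h⟩
    rw [mul_comm, ResiduatedRig.res_adj] at h
    exact hz.trans (Retic.mk_mono h)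

namespace FilterLE

variable {c d : Retic A} {a b a' b' : A}

theorem of_rigLE (h : RigLE a b) : FilterLE d a b :=
  filterLE_iff.2 ⟨1, le_top, by rwa [one_mul]⟩

theorem trans (h : FilterLE d a b) (h' : FilterLE d b b') : FilterLE d a b' := by
  obtain ⟨z, hz, h⟩ := filterLE_iff.1 h
  obtain ⟨w, hw, h'⟩ := filterLE_iff.1 h'
  refine filterLE_iff.2 ⟨w * z, le_inf hw hz, ?_⟩
  rw [mul_assoc]
  exact (h.mul_left w).trans h'

theorem mul (h : FilterLE d a b) (h' : FilterLE d a' b') : FilterLE d (a * a') (b * b') := by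
  obtain ⟨z, hz, h⟩ := filterLE_iff.1 h
  obtain ⟨w, hw, h'⟩ := filterLE_iff.1 h'
  refine filterLE_iff.2 ⟨z * w, le_inf hz hw, ?_⟩
  rw [mul_mul_mul_comm]
  exact h.mul h'

theorem add_le (h : FilterLE d a b) (h' : FilterLE d a' b) : FilterLE d (a + a') b := by
  obtain ⟨z, hz, h⟩ := filterLE_iff.1 h
  obtain ⟨w, hw, h'⟩ := filterLE_iff.1 h'
  refine filterLE_iff.2 ⟨z * w, le_inf hz hw, ?_⟩
  rw [mul_add]
  exact add_rigLE (((mul_rigLE_left z w).mul (RigLE.refl a)).trans h)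
    (((mul_rigLE_right z w).mul (RigLE.refl a')).trans h')

theorem add (h : FilterLE d a b) (h' : FilterLE d a' b') : FilterLE d (a + a') (b + b') :=
  add_le (h.trans (of_rigLE (rigLE_add_left _ _))) (h'.trans (of_rigLE (rigLE_add_right _ _)))

theorem adj {x y : A} : FilterLE d (a * x) y ↔ FilterLE d x (res a y) := by
  simp only [filterLE_iff, ← ResiduatedRig.res_adj, mul_left_comm]

theorem residual (h : FilterLE d a' a) (h' : FilterLE d b b') :
    FilterLE d (res a b) (res a' b') := by
  rw [← adj]
  exact (h.mul (of_rigLE (RigLE.refl _))).trans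
    ((of_rigLE (mul_res_rigLE a b)).trans h')

theorem one_le_iff : FilterLE d 1 a ↔ d ≤ Retic.mk a := by
  rw [FilterLE, one_res]

theorem mk_le (h : FilterLE d a b) : d ⊓ Retic.mk a ≤ Retic.mk b := by
  obtain ⟨z, hz, h⟩ := filterLE_iff.1 h
  exact (inf_le_inf_right _ hz).trans (Retic.mk_mono h)

end FilterLE

/-- The congruence of the filter of `d`. -/
def filterCon (d : Retic A) : RingCon A where
  r a b := FilterLE d a b ∧ FilterLE d b a
  iseqv :=
    { refl := fun a => ⟨.of_rigLE (RigLE.refl a), .of_rigLE (RigLE.refl a)⟩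
      symm := And.symm
      trans := fun h h' => ⟨h.1.trans h'.1, h'.2.trans h.2⟩ }
  add' h h' := ⟨h.1.add h'.1, h.2.add h'.2⟩
  mul' h h' := ⟨h.1.mul h'.1, h.2.mul h'.2⟩

/-- The quotient of `A` by the filter of `d`. -/
abbrev FilterQuot (d : Retic A) : Type u := (filterCon d).Quotient

/-! ### Quotients by filters: residuation, localization and gluing -/

namespace FilterQuot

variable {c d : Retic A} {a b : A}

/-- The projection to the quotient. -/
def mk (d : Retic A) : A →+* FilterQuot d := (filterCon d).mk'

theorem mk_surjective : Function.Surjective (mk d) := (filterCon d).mk'_surjective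

theorem mk_eq_mk : mk d a = mk d b ↔ FilterLE d a b ∧ FilterLE d b a := (filterCon d).eq

theorem mk_add_mk : mk d a + mk d b = mk d b ↔ FilterLE d a b := by
  rw [← map_add, mk_eq_mk]
  exact ⟨fun h => (FilterLE.of_rigLE (rigLE_add_left a b)).trans h.1,
    fun h => ⟨h.add_le (.of_rigLE (RigLE.refl b)), .of_rigLE (rigLE_add_right a b)⟩⟩

theorem add_idem (s : FilterQuot d) : s + s = s := by
  obtain ⟨a, rfl⟩ := mk_surjective s
  rw [← map_add, ResiduatedRig.add_idem]

theorem rigLE_mk : RigLE (mk d a) (mk d b) ↔ FilterLE d a b := by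
  rw [← mk_add_mk]
  constructor
  · rintro ⟨w, h⟩
    rw [← h, add_left_comm, add_idem]
  · exact fun h => ⟨mk d b, by rw [add_comm, h]⟩

instance : IntegralResiduatedRig (FilterQuot d) where
  add_idem := add_idem
  res := Quotient.map₂ res fun _ _ h _ _ h' => ⟨h.2.residual h'.1, h.1.residual h'.2⟩
  res_adj s t v := by
    obtain ⟨a, rfl⟩ := mk_surjective s
    obtain ⟨x, rfl⟩ := mk_surjective t
    obtain ⟨y, rfl⟩ := mk_surjective v
    rw [← map_mul, rigLE_mk]
    exact FilterLE.adj.trans rigLE_mk.symm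
  integral s := by
    obtain ⟨a, rfl⟩ := mk_surjective s
    rw [← map_one (mk d), ← map_add, IntegralResiduatedRig.integral]

variable (d) in
/-- The projection to the quotient as a morphism of residuated rigs. -/
def proj : ResHom A (FilterQuot d) where
  toRingHom := mk d
  map_res' _ _ := rfl

theorem mk_eq_one : mk d a = 1 ↔ d ≤ Retic.mk a := by
  rw [← map_one (mk d), mk_eq_mk, FilterLE.one_le_iff]
  exact and_iff_right (.of_rigLE (rigLE_one a))

/-- A morphism of residuated rigs that sends the filter of `d` to `1` factors through the
quotient. -/
def desc {B : Type u} [IntegralResiduatedRig B] (f : ResHom A B)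
    (hf : ∀ a, d ≤ Retic.mk a → f a = 1) : ResHom (FilterQuot d) B where
  toRingHom := (filterCon d).lift f.toRingHom (by
    intro a b h
    have key : ∀ {a b : A}, FilterLE d a b → RigLE (f a) (f b) := fun {a b} h => by
      rw [← res_eq_one_iff, ← f.map_res]
      exact hf _ h
    exact RigLE.antisymm IntegralResiduatedRig.integral (key h.1) (key h.2))
  map_res' s t := by
    obtain ⟨a, rfl⟩ := mk_surjective s
    obtain ⟨x, rfl⟩ := mk_surjective t
    exact f.map_res a x

/-- The restriction map between the quotients. -/
def restrict (h : c ≤ d) : ResHom (FilterQuot d) (FilterQuot c) :=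
  desc (proj c) fun _ ha => mk_eq_one.2 (h.trans ha)

/-- The target `C` may lack residuals, so `desc` does not apply. Instead the congruence is read as
`a * x ^ n ≤ b`, and `g` sends `x` to `1`. -/
theorem isLocalizationAt_mk (x : A) : IsLocalizationAt x (mk (Retic.mk x)) := by
  refine ⟨?_, fun C _ hC g hg => ?_⟩
  · rw [mk_eq_one.2 le_rfl]
    exact isUnit_one
  · have hx : g x = 1 := eq_one_of_isUnit hC hg
    have key : ∀ {a b : A}, FilterLE (Retic.mk x) a b → RigLE (g a) (g b) := fun {a b} h => by
      obtain ⟨n, hn⟩ := h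
      rw [← ResiduatedRig.res_adj] at hn
      have := hn.map g
      rwa [map_mul, map_pow, hx, one_pow, mul_one] at this
    refine ⟨(filterCon (Retic.mk x)).lift g fun _ _ h => RigLE.antisymm hC (key h.1) (key h.2),
      RingHom.ext fun _ => rfl, fun h hh => RingHom.ext fun s => ?_⟩
    obtain ⟨a, rfl⟩ := mk_surjective s
    exact congrArg (fun k => k a) hh

/-- Agreement on a finite cover implies agreement. -/
theorem separated (s : Finset (Retic A))
    (h : ∀ e ∈ s, mk e a = mk e b) : mk (s.sup id) a = mk (s.sup id) b := by
  simp only [mk_eq_mk] at h ⊢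
  -- `FilterLE e a b` says that `e` is below an element independent of `e`, so it passes to suprema.
  exact ⟨Finset.sup_le fun e he => (h e he).1, Finset.sup_le fun e he => (h e he).2⟩

/-- Gluing on a finite family. -/
theorem exists_glue (s : Finset (Retic A)) (a : Retic A → A)
    (h : ∀ e ∈ s, ∀ e' ∈ s, mk (e ⊓ e') (a e) = mk (e ⊓ e') (a e')) :
    ∃ g : A, ∀ e ∈ s, mk e g = mk e (a e) := by
  classical
  obtain ⟨r, hr⟩ := (Retic.mk_surjective (A := A)).hasRightInverse
  -- Agreement on the overlap, cleared of denominators. Membership sits under the existential so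
  -- that `n` can be chosen as a total function; outside `s` the value `0` is a dummy.
  have hn : ∀ e e', ∃ n : ℕ, e ∈ s → e' ∈ s → RigLE ((r e * r e') ^ n * a e') (a e) := by
    intro e e'
    by_cases he : e ∈ s
    · by_cases he' : e' ∈ s
      · have h1 : FilterLE (e ⊓ e') (a e') (a e) := (mk_eq_mk.1 (h e he e' he')).2
        rw [← hr e, ← hr e'] at h1
        obtain ⟨n, hn⟩ := h1
        rw [hr, hr, ← ResiduatedRig.res_adj] at hn
        exact ⟨n, fun _ _ => by rwa [mul_comm]⟩
      · exact ⟨0, fun _ h => (he' h).elim⟩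
    · exact ⟨0, fun h => (he h).elim⟩
  choose n hn using hn
  obtain ⟨N, hN⟩ : ∃ N, ∀ e ∈ s, ∀ e' ∈ s, n e e' ≤ N :=
    ⟨s.sup fun e => s.sup (n e), fun e he e' he' =>
      (Finset.le_sup (f := n e) he').trans (Finset.le_sup (f := fun e => s.sup (n e)) he)⟩
  -- The exponent is at least `N`, to absorb every `n e e'`, and positive even when `N = 0`, so that
  -- `y e` still has class `e`.
  let y : Retic A → A := fun e => r e ^ (N + 1)
  have hy : ∀ e, mk e (y e) = 1 := fun e => by
    rw [mk_eq_one, Retic.mk_pow_succ, hr]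
  -- Over `e` the weight `y e` is `1`, so the sum is at least `a e`; every other term is at most `a
  -- e` because `y e * y e' * a e' ≤ a e`.
  refine ⟨∑ e ∈ s, y e * a e, fun e he => ?_⟩
  refine RigLE.antisymm IntegralResiduatedRig.integral ?_ ?_
  · rw [map_sum]
    refine Finset.sum_induction _ (fun t => RigLE t (mk e (a e))) (fun _ _ => add_rigLE)
      (zero_rigLE _) fun e' he' => ?_
    have h1 : RigLE (y e * y e' * a e') (a e) := by
      refine RigLE.trans ?_ (hn e e' he he')
      rw [← mul_pow]
      exact (pow_rigLE_pow _ ((hN e he e' he').trans N.le_succ)).mul (RigLE.refl _)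
    have h2 := h1.map (mk e)
    rwa [mul_assoc, map_mul, hy, one_mul] at h2
  · rw [← Finset.add_sum_erase s _ he, map_add, map_mul, hy, one_mul]
    exact rigLE_add_left _ _

end FilterQuot

end Reticulation

/-! ### The representing sheaf -/

section Representation

variable (A : RiRig.{u})

/-- The reticulation, bundled. -/
abbrev reticLat : BddDistLat.{u} := BddDistLat.of (Retic A)

/-- The presheaf of quotients of `A` on its reticulation. -/
def reticSheaf : (reticLat A : Type u)ᵒᵖ ⥤ RiRig.{u} where
  obj d := ⟨FilterQuot (A := A) d.unop⟩
  map i := FilterQuot.restrict (leOfHom i.unop)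
  map_id d := ResHom.ext fun s => by
    obtain ⟨a, rfl⟩ := FilterQuot.mk_surjective s
    rfl
  map_comp i j := ResHom.ext fun s => by
    obtain ⟨a, rfl⟩ := FilterQuot.mk_surjective s
    rfl

/-- Gluing takes place over the finite family `s` only; on the remaining arrows of the sieve the
glued section is correct by separation. -/
theorem reticSheaf_isSheaf :
    Presieve.IsSheaf (coherentTop (reticLat A)) (reticSheaf A ⋙ forget RiRig.{u}) := by
  classical
  rintro d S ⟨s, hs, hd⟩ x hx
  have hle : ∀ c ∈ s, c ≤ d := fun c hc => (hs c hc).1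
  have hcompat : ∀ {c e : reticLat A} (hc : c ≤ d) (he : e ≤ d) (h : e ≤ c)
      (hSc : S.arrows (homOfLE hc)) (hSe : S.arrows (homOfLE he)),
      ((reticSheaf A).map (homOfLE h).op : ResHom _ _) (x (homOfLE hc) hSc) =
        x (homOfLE he) hSe := by
    intro c e hc he h hSc hSe
    have := hx (homOfLE h) (𝟙 e) hSc hSe rfl
    exact this.trans (congrArg (fun k : ResHom (FilterQuot e) (FilterQuot e) =>
      k (x (homOfLE he) hSe)) ((reticSheaf A).map_id (op e)))
  have hrep : ∀ c : reticLat A, ∃ a : A, ∀ (hc : c ≤ d) (h : S.arrows (homOfLE hc)),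
      FilterQuot.mk c a = x (homOfLE hc) h := by
    intro c
    by_cases h : ∃ hc : c ≤ d, S.arrows (homOfLE hc)
    · obtain ⟨hc, h⟩ := h
      obtain ⟨a, ha⟩ := FilterQuot.mk_surjective (x (homOfLE hc) h)
      exact ⟨a, fun _ _ => ha⟩
    · exact ⟨0, fun hc hS => (h ⟨hc, hS⟩).elim⟩
  choose a ha using hrep
  have hmk : ∀ {c e : reticLat A} (hc : c ≤ d) (hSc : S.arrows (homOfLE hc)) (h : e ≤ c),
      FilterQuot.mk e (a c) = FilterQuot.mk e (a e) := by
    intro c e hc hSc h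
    have hSe : S.arrows (homOfLE (h.trans hc)) := S.downward_closed hSc (homOfLE h)
    rw [ha e (h.trans hc) hSe, ← hcompat hc (h.trans hc) h hSc hSe, ← ha c hc hSc]
    rfl
  obtain ⟨g, hg⟩ := FilterQuot.exists_glue s a fun e he e' he' =>
    (hmk (hs e he).1 (hs e he).2 inf_le_left).trans
      (hmk (hs e' he').1 (hs e' he').2 inf_le_right).symm
  refine ⟨FilterQuot.mk d g, ?_, ?_⟩
  · intro c i hi
    have hc : c ≤ d := leOfHom i
    change FilterQuot.mk c g = x (homOfLE hc) hi
    rw [← ha c hc hi]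
    -- The elements `c ⊓ e` cover `c`, and over each of them both sections are known to agree.
    have hcov : (s.image (fun e => c ⊓ e)).sup id = c := by
      rw [Finset.sup_image]
      change s.sup (fun e => c ⊓ id e) = c
      rw [← Finset.sup_inf_distrib_left, hd]
      exact inf_eq_left.2 hc
    have hsep := FilterQuot.separated (a := g) (b := a c) (s.image (fun e => c ⊓ e)) ?_
    · rwa [hcov] at hsep
    · intro e' he'
      obtain ⟨e, he, rfl⟩ := Finset.mem_image.1 he'
      have h1 := congrArg (FilterQuot.restrict (inf_le_right : c ⊓ e ≤ e)) (hg e he)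
      refine h1.trans ?_
      exact (hmk (hs e he).1 (hs e he).2 inf_le_right).trans (hmk hc hi inf_le_left).symm
  · intro t ht
    obtain ⟨b, rfl⟩ := FilterQuot.mk_surjective t
    have hsep := FilterQuot.separated (a := b) (b := g) s fun e he => by
      rw [hg e he, ha e (hs e he).1 (hs e he).2]
      exact ht (homOfLE (hs e he).1) (hs e he).2
    rwa [hd] at hsep

/-- The morphism from the representing sheaf to `Λ`; it sends the class of `a` at stage `d` to
`η a ⊓ d`. -/
def reticChi : reticSheaf A ⋙ toRig ⟶ Lambda (reticLat A) where
  app d := CommSemiRingCat.ofHom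
    ((filterCon d.unop).lift
      (RingHom.comp (Below.restrict (le_top : d.unop ≤ ⊤))
        { toFun := fun a : A => (⟨Retic.mk a, le_top⟩ : Below (⊤ : Retic A))
          map_one' := rfl
          map_mul' := fun _ _ => rfl
          map_zero' := rfl
          map_add' := fun _ _ => rfl })
      (fun a b h => Subtype.ext (le_antisymm
        (le_inf ((inf_comm (Retic.mk a) d.unop).trans_le h.1.mk_le) inf_le_right)
        (le_inf ((inf_comm (Retic.mk b) d.unop).trans_le h.2.mk_le) inf_le_right))))
  naturality d e i := by
    ext s
    obtain ⟨a, rfl⟩ := FilterQuot.mk_surjective s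
    refine Subtype.ext ?_
    change Retic.mk a ⊓ e.unop = Retic.mk a ⊓ d.unop ⊓ e.unop
    rw [inf_assoc, inf_eq_right.2 (leOfHom i.unop)]

/-- The representation of an integral residuated rig on its reticulation. -/
def reticRep : ResRep.{u} where
  base := reticLat A
  X := reticSheaf A
  isSheaf := reticSheaf_isSheaf A
  χ := reticChi A
  isLocal d := ⟨fun s hs => by
    obtain ⟨a, rfl⟩ := FilterQuot.mk_surjective s
    have h1 : ((reticChi A).app d).hom (FilterQuot.mk d.unop a) = (1 : Below d.unop) :=
      eq_one_of_isUnit (fun x : Below d.unop => Subtype.ext (sup_eq_left.2 x.2)) hs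
    have h2 : d.unop ≤ Retic.mk a := inf_eq_right.1 (congrArg Subtype.val h1)
    rw [FilterQuot.mk_eq_one.2 h2]
    exact isUnit_one⟩

/-- The unit of the adjunction: the projection of `A` to the quotient at the top. -/
def reticUnit : A ⟶ Gamma.obj (reticRep A) := FilterQuot.proj ⊤

theorem toBase_reticUnit (x : A) : (toBase (reticRep A) (reticUnit A) x).1 = Retic.mk x :=
  inf_top_eq _

theorem isReticulation_reticUnit : IsReticulation (toBase (reticRep A) (reticUnit A)) := by
  intro E g
  refine ⟨Retic.lift g, fun x => ?_, fun f hf => ?_⟩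
  · rw [toBase_reticUnit]
    exact Retic.lift_mk g x
  · ext d
    obtain ⟨x, rfl⟩ := Retic.mk_surjective d
    exact (congrArg f.hom (toBase_reticUnit A x)).symm.trans (hf x)

theorem isLocalizationAt_reticUnit (x : A) : IsLocalizationAt x
    (toSection (reticRep A) (reticUnit A) (toBase (reticRep A) (reticUnit A) x).1) := by
  rw [toBase_reticUnit]
  exact FilterQuot.isLocalizationAt_mk x

/-- The filter of `⊤` is `{1}`, so its congruence is equality. -/
theorem reticUnit_bijective : Function.Bijective (FilterQuot.mk (A := A) ⊤) := by
  refine ⟨fun a b h => ?_, FilterQuot.mk_surjective⟩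
  have key : ∀ {a b : A}, FilterLE ⊤ a b → RigLE a b := fun {a b} h =>
    (res_eq_one_iff a b).1 (Retic.top_le_mk_iff.1 h)
  exact RigLE.antisymm A.str.integral (key (FilterQuot.mk_eq_mk.1 h).1)
    (key (FilterQuot.mk_eq_mk.1 h).2)

instance : IsIso (reticUnit A) := by
  let e := Equiv.ofBijective _ (reticUnit_bijective A)
  refine ⟨⟨{ toFun := e.symm
             map_one' := e.injective (e.apply_symm_apply _)
             map_zero' := e.injective (e.apply_symm_apply _)
             map_mul' := fun s t => ?_
             map_add' := fun s t => ?_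
             map_res' := fun s t => ?_ }, ?_, ?_⟩⟩
  · obtain ⟨a, rfl⟩ := e.surjective s
    obtain ⟨b, rfl⟩ := e.surjective t
    rw [e.symm_apply_apply, e.symm_apply_apply]
    exact e.symm_apply_apply (a * b)
  · obtain ⟨a, rfl⟩ := e.surjective s
    obtain ⟨b, rfl⟩ := e.surjective t
    rw [e.symm_apply_apply, e.symm_apply_apply]
    exact e.symm_apply_apply (a + b)
  · obtain ⟨a, rfl⟩ := e.surjective s
    obtain ⟨b, rfl⟩ := e.surjective t
    rw [e.symm_apply_apply, e.symm_apply_apply]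
    exact e.symm_apply_apply (res a b)
  · exact ResHom.ext fun a => e.symm_apply_apply a
  · exact ResHom.ext fun s => e.apply_symm_apply s

/-! ### The universal property of the unit -/

variable {A}

theorem map_eq_one_iff_le_chi (P : ResRep.{u}) {c d : P.base} (h : c ≤ d)
    (x : P.X.obj (op d)) : (P.X.map (homOfLE h).op : ResHom _ _) x = 1 ↔
      c ≤ Subtype.val ((P.χ.app (op d)).hom x : Below d) :=
  (le_chi_iff P.base P.X P.χ P.isLocal h x).symm

/-- The morphism of representations induced by a morphism to the global sections. -/
def reticLift (P : ResRep.{u}) (u : A ⟶ Gamma.obj P) : reticRep A ⟶ P :=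
  { f := Retic.lift (toBase P u)
    φ :=
      { app := fun d => FilterQuot.desc
          (u ≫ P.X.map (homOfLE (le_top : (Retic.lift (toBase P u)).hom d.unop ≤ ⊤)).op)
          -- Applying `f` to `d ≤ η a` gives `f d ≤ χ (u a)`, so `u a` restricts to `1` over `f d`.
          (fun a ha => (map_eq_one_iff_le_chi P _ _).2
            (OrderHomClass.mono (Retic.lift (toBase P u)).hom ha))
        naturality := fun d e i => ResHom.ext fun s => by
          obtain ⟨a, rfl⟩ := FilterQuot.mk_surjective s
          exact congrArg (fun k : ResHom _ _ => k ((u : ResHom _ _) a))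
            (P.X.map_comp (homOfLE le_top).op
              ((latFun (Retic.lift (toBase P u))).map i)) }
    comm := by
      ext d s
      obtain ⟨a, rfl⟩ := FilterQuot.mk_surjective s
      have h := congrArg (fun k => k.hom ((u : ResHom _ _) a)) (P.χ.naturality
        (homOfLE (le_top : (Retic.lift (toBase P u)).hom d.unop ≤ ⊤)).op)
      -- Naturality turns `χ` of the restriction into `f (η a) ⊓ f d`, which is `f (η a ⊓ d)`.
      refine h.trans (Subtype.ext ?_)
      exact (map_inf (Retic.lift (toBase P u)).hom (Retic.mk a) d.unop).symm }

theorem reticUnit_map_reticLift (P : ResRep.{u}) (u : A ⟶ Gamma.obj P) :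
    reticUnit A ≫ Gamma.map (reticLift P u) = u := ResHom.ext fun a => by
  have h1 := congrArg (fun k : ResHom _ _ => k ((u : ResHom _ _) a))
    (P.X.map_comp (homOfLE (le_top : (Retic.lift (toBase P u)).hom ⊤ ≤ ⊤)).op
      (homOfLE (map_top (Retic.lift (toBase P u)).hom).ge).op)
  have h2 := congrArg (fun k : ResHom _ _ => k ((u : ResHom _ _) a)) (P.X.map_id (op ⊤))
  exact h1.symm.trans h2

/-- Compatibility with `χ` at `⊤` makes the lattice part of `F` determined, on the image of `toBase
P u`, by the action of `F` on global sections. -/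
theorem toBase_comp_map {P Q : ResRep.{u}} (F : P ⟶ Q) (u : A ⟶ Gamma.obj P) (a : A) :
    (toBase Q (u ≫ Gamma.map F) a).1 = F.f.hom (toBase P u a).1 := by
  have h1 := congrArg (fun k => k.hom (F.φ.app (op ⊤) ((u : ResHom _ _) a))) (Q.χ.naturality
    (homOfLE (map_top F.f.hom).ge : (⊤ : Q.base) ⟶ F.f.hom ⊤).op)
  have h2 := congrArg (fun k => (k.app (op ⊤)).hom ((u : ResHom _ _) a)) F.comm
  refine (congrArg Subtype.val h1).trans ?_
  exact (inf_top_eq _).trans (congrArg Subtype.val h2)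

/-- Surjectivity of `η` fixes the lattice part. Every section is the restriction of a global one, so
naturality then fixes the sheaf part. -/
theorem reticRep_hom_ext {P : ResRep.{u}} {F G : reticRep A ⟶ P}
    (h : reticUnit A ≫ Gamma.map F = reticUnit A ≫ Gamma.map G) : F = G := by
  have hf : F.f = G.f := by
    ext d
    obtain ⟨a, rfl⟩ := Retic.mk_surjective d
    have hF := toBase_comp_map F (reticUnit A) a
    have hG := toBase_comp_map G (reticUnit A) a
    rw [toBase_reticUnit] at hF hG
    exact hF.symm.trans ((congrArg (fun k => (toBase P k a).1) h).trans hG)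
  obtain ⟨f, φ, hφ⟩ := F
  obtain ⟨g, γ, hγ⟩ := G
  obtain rfl : f = g := hf
  obtain rfl : φ = γ := by
    have htop : ∀ a : A, (φ.app (op ⊤) : ResHom _ _) (FilterQuot.mk ⊤ a) =
        (γ.app (op ⊤) : ResHom _ _) (FilterQuot.mk ⊤ a) := by
      intro a
      have h1 := congrArg (fun k : ResHom _ _ =>
        (P.X.map (homOfLE (le_top : f.hom ⊤ ≤ ⊤)).op : ResHom _ _) (k a)) h
      -- `f ⊤` and `⊤` are not definitionally equal, so `Γ` inserts a restriction between them; this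
      -- round trip cancels it.
      have key : ∀ y : P.X.obj (op (f.hom ⊤)),
          (P.X.map (homOfLE (le_top : f.hom ⊤ ≤ ⊤)).op : ResHom _ _)
            ((P.X.map (homOfLE (map_top f.hom).ge : (⊤ : P.base) ⟶ f.hom ⊤).op :
              ResHom _ _) y) = y := fun y =>
        (congrArg (fun k : ResHom _ _ => k y) (P.X.map_comp
          (homOfLE (map_top f.hom).ge : (⊤ : P.base) ⟶ f.hom ⊤).op
          (homOfLE (le_top : f.hom ⊤ ≤ ⊤)).op)).symm.trans
          (congrArg (fun k : ResHom _ _ => k y) (P.X.map_id _))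
      exact (key _).symm.trans (h1.trans (key _))
    ext d s
    obtain ⟨a, rfl⟩ := FilterQuot.mk_surjective s
    have nF := congrArg (fun k : ResHom _ _ => k (FilterQuot.mk ⊤ a))
      (φ.naturality (homOfLE (le_top : d.unop ≤ ⊤)).op)
    have nG := congrArg (fun k : ResHom _ _ => k (FilterQuot.mk ⊤ a))
      (γ.naturality (homOfLE (le_top : d.unop ≤ ⊤)).op)
    exact nF.trans ((congrArg (P.X.map ((latFun f).map (homOfLE (le_top : d.unop ≤ ⊤)).op) :
      ResHom _ _) (htop a)).trans nG.symm)
  rfl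

theorem reticRep_prelinear (hA : Prelinear A) : prelinearRep (reticRep A) := fun d s t => by
  obtain ⟨a, rfl⟩ := FilterQuot.mk_surjective s
  obtain ⟨b, rfl⟩ := FilterQuot.mk_surjective t
  exact congrArg (FilterQuot.mk d.unop) (hA a b)

end Representation

/-! ### The adjunction -/

/-- The object part of the left adjoint. -/
def leftObj (A : PliRig.{u}) : PlRep.{u} := ⟨reticRep A.obj, reticRep_prelinear A.property⟩

/-- The hom-set bijection of the adjunction. -/
def leftEquiv (A : PliRig.{u}) (P : PlRep.{u}) : (leftObj A ⟶ P) ≃ (A ⟶ GammaPl.obj P) where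
  toFun F := ⟨reticUnit A.obj ≫ Gamma.map F.hom⟩
  invFun u := ⟨reticLift P.obj u.hom⟩
  left_inv _ := ObjectProperty.hom_ext _ (reticRep_hom_ext (reticUnit_map_reticLift _ _))
  right_inv _ := ObjectProperty.hom_ext _ (reticUnit_map_reticLift _ _)

theorem leftEquiv_comp (A : PliRig.{u}) (P Q : PlRep.{u}) (F : P ⟶ Q) (G : leftObj A ⟶ P) :
    leftEquiv A Q (G ≫ F) = leftEquiv A P G ≫ GammaPl.map F :=
  ObjectProperty.hom_ext _ (by
    change reticUnit A.obj ≫ Gamma.map (G.hom ≫ F.hom) =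
      (reticUnit A.obj ≫ Gamma.map G.hom) ≫ Gamma.map F.hom
    exact (congrArg (reticUnit A.obj ≫ ·) (Gamma.map_comp G.hom F.hom)).trans
      (Category.assoc _ _ _).symm)

/-- The left adjoint of the functor of global sections. -/
def left : PliRig.{u} ⥤ PlRep.{u} := Adjunction.leftAdjointOfEquiv leftEquiv leftEquiv_comp

/-- The adjunction. -/
def leftAdj : left.{u} ⊣ GammaPl.{u} := Adjunction.adjunctionOfEquivLeft leftEquiv leftEquiv_comp

/-- The unit is the hom-set bijection applied to the identity, which ties the abstract adjunction to
the explicit projection. -/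
theorem leftAdj_unit_app (A : PliRig.{u}) : (leftAdj.unit.app A).hom = reticUnit A.obj := by
  have h : leftAdj.unit.app A = leftEquiv A (leftObj A) (𝟙 _) := by
    rw [← leftAdj.homEquiv_id A]
    simp [leftAdj, Adjunction.adjunctionOfEquivLeft, left]
    rfl
  rw [h]
  change reticUnit A.obj ≫ Gamma.map (𝟙 (reticRep A.obj)) = _
  rw [Gamma.map_id]
  exact Category.comp_id (reticUnit A.obj)

instance : IsIso leftAdj.{u}.unit := by
  have : ∀ A, IsIso (leftAdj.{u}.unit.app A) := fun A => by
    have : IsIso (prelinearRig.ι.map (leftAdj.{u}.unit.app A)) := by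
      change IsIso (leftAdj.unit.app A).hom
      rw [leftAdj_unit_app]
      exact inferInstanceAs (IsIso (reticUnit A.obj))
    exact isIso_of_fully_faithful prelinearRig.ι _
  exact NatIso.isIso_of_isIso_app _

/-! ### Fibers and really local rigs -/

/-- If `0 = 1` in the fiber, then already over some `j` with `p j = ⊤`; applying `χ` there forces `j
= ⊥`, contradicting `p ⊥ = ⊥`. -/
theorem stalk_nontrivial (P : ResRep.{u}) (p : BoundedLatticeHom P.base Bool) :
    Nontrivial (Stalk P.X p) := by
  refine ⟨0, 1, fun h => ?_⟩
  let i : Nhd p := OrderDual.toDual ⟨⊤, map_top p⟩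
  rw [DirectLimit.zero_def i, DirectLimit.one_def i, Quotient.eq] at h
  obtain ⟨j, hj, _, h⟩ := h
  rw [map_zero, map_one] at h
  have h1 := congrArg (P.χ.app (op j.ofDual.1)).hom h
  have h2 : (⊥ : P.base) = j.ofDual.1 := congrArg Subtype.val
    ((map_zero (P.χ.app (op j.ofDual.1)).hom).symm.trans
      (h1.trans (map_one (P.χ.app (op j.ofDual.1)).hom)))
  have h3 := j.ofDual.2
  rw [← h2, map_bot] at h3
  exact absurd h3 (by decide)

theorem stalk_totallyOrdered (P : ResRep.{u}) (hP : prelinearRep P)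
    (p : BoundedLatticeHom P.base Bool) : TotallyOrdered (Stalk P.X p) := by
  refine DirectLimit.induction₂ _ fun i x y => ?_
  let χ : P.X.obj (op i.ofDual.1) →+* Below i.ofDual.1 := (P.χ.app (op i.ofDual.1)).hom
  have key : ∀ x y : P.X.obj (op i.ofDual.1), p (χ (res x y)).1 = ⊤ →
      RigLE (⟦⟨i, x⟩⟧ : Stalk P.X p) ⟦⟨i, y⟩⟧ := by
    intro x y h
    -- This is the largest element below `i` over which `res x y` becomes `1`, that is, over which
    -- `x ≤ y`.
    let j : Nhd p := OrderDual.toDual ⟨(χ (res x y)).1, h⟩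
    have hij : i ≤ j := (χ (res x y)).2
    have h1 : nhdMap P.X p i j hij (res x y) = 1 :=
      (map_eq_one_iff_le_chi P (χ (res x y)).2 _).2 le_rfl
    rw [ResHom.map_res, res_eq_one_iff, rigLE_iff] at h1
    rw [rigLE_iff, DirectLimit.add_def, Quotient.eq]
    exact ⟨j, hij, hij, by rw [map_add]; exact h1⟩
  have h1 : (χ (res x y)).1 ⊔ (χ (res y x)).1 = i.ofDual.1 :=
    congrArg Subtype.val ((map_add χ _ _).symm.trans ((congrArg χ (hP _ x y)).trans (map_one χ)))
  have h2 : p (χ (res x y)).1 ⊔ p (χ (res y x)).1 = ⊤ := by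
    rw [← map_sup, h1]
    exact i.ofDual.2
  -- Points are prime: a join sent to `⊤` has a member sent to `⊤`.
  rcases Bool.or_eq_true_iff.1 h2 with h | h
  · exact Or.inl (key x y h)
  · exact Or.inr (key y x h)

/-- Locality splits `res a b + res b a = 1` into a unit, hence an equality with `1`, hence a
comparison. Conversely, under a total order a sum equals one of its summands. -/
theorem reallyLocal_iff {A : Type u} [IntegralResiduatedRig A] (hA : Prelinear A) :
    ReallyLocal A ↔ Nontrivial A ∧ TotallyOrdered A := by
  constructor
  · intro h
    refine ⟨⟨0, 1, fun h01 => h.map_zero.1 (h01 ▸ isUnit_one)⟩, fun a b => ?_⟩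
    have hu : IsUnit (res a b + res b a) := hA a b ▸ isUnit_one
    refine ((h.map_add _ _).1 hu).imp ?_ ?_ <;> exact fun h =>
      (res_eq_one_iff _ _).1 ((isUnit_iff_eq_one _).1 h)
  · rintro ⟨_, htot⟩
    refine ⟨iff_false_intro not_isUnit_zero, iff_true_intro isUnit_one, fun x y => ?_,
      fun x y => IsUnit.mul_iff⟩
    simp only [isUnit_iff_eq_one]
    constructor
    · intro h
      rcases htot x y with hxy | hxy
      · exact Or.inr (((rigLE_iff _ _).1 hxy).symm.trans h)
      · exact Or.inl (((rigLE_iff _ _).1 hxy).symm.trans (by rw [add_comm, h]))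
    · rintro (rfl | rfl)
      · exact IntegralResiduatedRig.integral y
      · rw [add_comm]
        exact IntegralResiduatedRig.integral x

end PrelinearRep

end

theorem mainTheorem3 :
    (∃ (L : PrelinearRep.PliRig.{u} ⥤ PrelinearRep.PlRep.{u})
        (adj : L ⊣ PrelinearRep.GammaPl.{u}),
      L.Full ∧ L.Faithful ∧ IsIso adj.unit ∧
      ∀ A : PrelinearRep.PliRig.{u},
        PrelinearRep.IsReticulation
          (PrelinearRep.toBase (L.obj A).obj (adj.unit.app A).hom) ∧
        ∀ x : A.obj,
          PrelinearRep.IsLocalizationAt x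
            (PrelinearRep.toSection (L.obj A).obj (adj.unit.app A).hom
              (PrelinearRep.toBase (L.obj A).obj (adj.unit.app A).hom x).1)) ∧
    (∀ (P : PrelinearRep.PlRep.{u}) (p : BoundedLatticeHom P.obj.base Bool),
      Nontrivial (PrelinearRep.Stalk P.obj.X p) ∧
      PrelinearRep.TotallyOrdered (PrelinearRep.Stalk P.obj.X p)) ∧
    (∀ A : PrelinearRep.PliRig.{u},
      PrelinearRep.ReallyLocal A.obj ↔
        (Nontrivial A.obj ∧ PrelinearRep.TotallyOrdered A.obj)) := by
  refine ⟨⟨PrelinearRep.left, PrelinearRep.leftAdj,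
    PrelinearRep.leftAdj.fullyFaithfulLOfIsIsoUnit.full,
    PrelinearRep.leftAdj.fullyFaithfulLOfIsIsoUnit.faithful, inferInstance, fun A => ?_⟩,
    fun P p => ⟨PrelinearRep.stalk_nontrivial P.obj p,
      PrelinearRep.stalk_totallyOrdered P.obj P.property p⟩,
    fun A => PrelinearRep.reallyLocal_iff A.property⟩
  rw [PrelinearRep.leftAdj_unit_app]
  exact ⟨PrelinearRep.isReticulation_reticUnit A.obj,
    PrelinearRep.isLocalizationAt_reticUnit A.obj⟩
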